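/- Let $D$ be an integral domain with quotient field $K$. For a nonzero fractional ideal $I$ of $D$ put $I^{-1}=\{x\in K : xI\subseteq D\}$, $I_v=(I^{-1})^{-1}$, and $I_t=\bigcup J_v$, the union over all nonzero finitely generated fractional ideals $J\subseteq I$. A nonzero ideal $I$ of $D$ is a $t$-ideal if $I_t=I$; a maximal $t$-ideal is an ideal that is maximal among the proper $t$-ideals of $D$. A maximal $t$-ideal $P$ is potent if it contains a nonzero finitely generated ideal that is not contained in any other maximal $t$-ideal. Suppose that $D$ is a Prüfer $v$-multiplication domain (PVMD), that is, $(II^{-1})_t=D$ for every nonzero finitely generated fractional ideal $I$ of $D$. Then the following are equivalent. 1. $D$ is a generalized Krull domain: there is a set $\mathcal V$ of valuation rings of $K$ of rank (Krull dimension) one, each of the form $D_P$ for some prime ideal $P$ of $D$, such that $D=\bigcap_{V\in\mathcal V}V$ and every nonzero element of $D$ is a nonunit in only finitely many $V\in\mathcal V$. (The empty intersection is $K$, so a field is a generalized Krull domain.) 2. $D$ is completely integrally closed (if $x\in K$ and there is a nonzero $r\in D$ with $rx^n\in D$ for all $n\ge 1$, then $x\in D$), and every maximal $t$-ideal of $D$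 is potent. -/

import Mathlib

open scoped nonZeroDivisors

noncomputable section

namespace TOperation

section Closures

variable {D K : Type*} [CommRing D] [IsDomain D] [Field K] [Algebra D K] [IsFractionRing D K]

/-- The `v`-closure `I_v = (I⁻¹)⁻¹`, where `I⁻¹ = (D :_K I)` (and `0⁻¹ = 0`, so that `0_v = 0`). -/
def vClosure (I : FractionalIdeal D⁰ K) : FractionalIdeal D⁰ K := (I⁻¹)⁻¹

theorem inv_ne_zero_of_ne_zero {I : FractionalIdeal D⁰ K} (hI : I ≠ 0) : I⁻¹ ≠ 0 := by
  obtain ⟨a, ha, haI⟩ := I.isFractional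
  intro h
  have hmem : algebraMap D K a ∈ I⁻¹ := by
    rw [FractionalIdeal.mem_inv_iff hI]
    intro y hy
    obtain ⟨b, hb⟩ := haI y hy
    rw [FractionalIdeal.mem_one_iff]
    exact ⟨b, by rw [hb, Algebra.smul_def]⟩
  rw [h, FractionalIdeal.mem_zero_iff] at hmem
  exact nonZeroDivisors.ne_zero ha
    ((map_eq_zero_iff _ (IsFractionRing.injective D K)).mp hmem)

theorem vClosure_mono {I J : FractionalIdeal D⁰ K} (h : J ≤ I) : vClosure J ≤ vClosure I := by
  by_cases hJ : J = 0
  · have h0 : vClosure J = 0 := by simp [vClosure, hJ, FractionalIdeal.inv_eq]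
    rw [h0]
    exact FractionalIdeal.zero_le _
  · have hI : I ≠ 0 := fun h0 => hJ (le_antisymm (h0 ▸ h) (FractionalIdeal.zero_le J))
    exact FractionalIdeal.inv_anti_mono (inv_ne_zero_of_ne_zero hI) (inv_ne_zero_of_ne_zero hJ)
      (FractionalIdeal.inv_anti_mono hJ hI h)

/-- The `t`-closure `I_t`, the union of the `J_v` over the finitely generated fractional ideals
`J ⊆ I`. Allowing `J = 0` makes no difference, as `0_v = 0`. -/
def tClosure (I : FractionalIdeal D⁰ K) : FractionalIdeal D⁰ K :=
  ⟨{ carrier := {x : K | ∃ J : FractionalIdeal D⁰ K,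
        (J : Submodule D K).FG ∧ J ≤ I ∧ x ∈ vClosure J}
     zero_mem' := ⟨0, by simpa using Submodule.fg_bot, FractionalIdeal.zero_le I,
        Submodule.zero_mem (vClosure 0 : FractionalIdeal D⁰ K).1⟩
     add_mem' := by
        rintro x y ⟨J, hJ, hJI, hx⟩ ⟨L, hL, hLI, hy⟩
        refine ⟨J ⊔ L, ?_, sup_le hJI hLI, ?_⟩
        · rw [FractionalIdeal.coe_sup]
          exact hJ.sup hL
        · exact Submodule.add_mem (vClosure (J ⊔ L)).1 (vClosure_mono le_sup_left hx)
            (vClosure_mono le_sup_right hy)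
     smul_mem' := by
        rintro c x ⟨J, hJ, hJI, hx⟩
        exact ⟨J, hJ, hJI, Submodule.smul_mem (vClosure J).1 c hx⟩ }, by
    obtain ⟨a, ha, h⟩ := (vClosure I).isFractional
    refine ⟨a, ha, ?_⟩
    rintro b ⟨J, _, hJI, hb⟩
    exact h b (vClosure_mono hJI hb)⟩

end Closures

variable (D K : Type*) [CommRing D] [IsDomain D] [Field K] [Algebra D K] [IsFractionRing D K]

/-- `D` is a Prüfer `v`-multiplication domain (PVMD): every nonzero finitely generated
fractional ideal `I` of `D` is `t`-invertible, i.e. `(I I⁻¹)_t = D`. -/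
def IsPVMD : Prop :=
  ∀ I : FractionalIdeal D⁰ K, I ≠ 0 → (I : Submodule D K).FG → tClosure (I * I⁻¹) = 1

variable {D}

/-- A nonzero integral ideal `I` of `D` is a `t`-ideal if `I_t = I`. -/
def IsTIdeal (I : Ideal D) : Prop :=
  I ≠ ⊥ ∧ tClosure (I : FractionalIdeal D⁰ K) = (I : FractionalIdeal D⁰ K)

/-- A maximal `t`-ideal: maximal among the proper integral `t`-ideals. -/
def IsMaximalTIdeal (P : Ideal D) : Prop :=
  Maximal (fun I : Ideal D => IsTIdeal K I ∧ I ≠ ⊤) P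

/-- `P` contains a nonzero finitely generated ideal that is not contained in any maximal
`t`-ideal other than `P`. (Used for maximal `t`-ideals `P`.) -/
def IsPotent (P : Ideal D) : Prop :=
  ∃ J : Ideal D, J ≠ ⊥ ∧ J.FG ∧ J ≤ P ∧ ∀ Q : Ideal D, IsMaximalTIdeal K Q → J ≤ Q → Q = P

variable {K} in
variable (D) in
/-- A valuation ring `V` of `K` is essential for `D` if `V = D_P` (inside `K`) for some
prime ideal `P` of `D`. -/
def IsEssential (V : ValuationSubring K) : Prop :=
  ∃ (P : Ideal D) (_ : P.IsPrime), (V : Set K) =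
    (Localization.subalgebra.ofField K P.primeCompl P.primeCompl_le_nonZeroDivisors : Set K)

variable (D)

/-- Generalized Krull domain: `D` is the intersection (inside `K`) of a family of essential
valuation rings of rank (i.e. Krull dimension) one, and the family is locally finite: every
nonzero element of `D` is a nonunit in only finitely many members. The empty intersection
is `K`. -/
def IsGeneralizedKrull : Prop :=
  ∃ 𝒱 : Set (ValuationSubring K),
    (∀ V ∈ 𝒱, IsEssential D V ∧ ringKrullDim V = 1) ∧
    (∀ x : K, x ∈ (algebraMap D K).range ↔ ∀ V ∈ 𝒱, x ∈ V) ∧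
    (∀ d : D, d ≠ 0 → {V ∈ 𝒱 | algebraMap D K d ∈ V.nonunits}.Finite)

/-- `D` is completely integrally closed: every element `x` of `K` for which there is a nonzero
`r ∈ D` with `r xⁿ ∈ D` for all `n` lies in `D`. -/
def IsCompletelyIntegrallyClosed : Prop :=
  completeIntegralClosure D K = ⊥

end TOperation

end

open scoped nonZeroDivisors

/-! Any domain `D` is the intersection of its localizations `D_P` at maximal `t`-ideals, and in a
PVMD these are valuation rings.

(1 ⇒ 2) Rank-one valuation rings are completely integrally closed, hence so is their intersection.
Prime avoidance shows that a maximal `t`-ideal containing `d ≠ 0` is the center of one of the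
finitely many `V` in which `d` is a nonunit. So `d` lies in finitely many maximal `t`-ideals, and a
second avoidance gives potency.

(2 ⇒ 1) The family is that of all `D_P`. Rank one: otherwise `a/yⁿ ∈ D_P` for all `n`, for some `a ≠
0` and nonunit `y`. If `J` witnesses potency of `P` and `b` is a numerator of `y`, every `x` with
`x(J + bD) ⊆ D` is almost integral, so lies in `D`. Thus `1 ∈ (J + bD)_v ⊆ P`, a contradiction.
Local finiteness: otherwise Zorn gives a prime `t`-ideal containing no finitely generated ideal that
lies in only finitely many maximal `t`-ideals. By rank one it is a maximal `t`-ideal, contradicting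
potency. -/

namespace TOperation

/-! ### Rank one as an Archimedean divisibility condition -/

section RankOne

variable {R : Type*} [CommRing R] [IsDomain R] [IsLocalRing R]

theorem exists_dvd_pow_of_ringKrullDim_eq_one (h : ringKrullDim R = 1) {a y : R} (ha : a ≠ 0)
    (hy : y ∈ IsLocalRing.maximalIdeal R) : ∃ n : ℕ, a ∣ y ^ n := by
  have : Ring.KrullDimLE 1 R := Ring.krullDimLE_iff.mpr (by exact_mod_cast h.le)
  have hrad : y ∈ (Ideal.span {a}).radical := by
    rw [Ideal.radical_eq_sInf, Ideal.mem_sInf]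
    rintro J ⟨haJ, hJ⟩
    have hJ0 : J ≠ ⊥ := by
      rintro rfl
      exact ha (by simpa using haJ)
    rwa [IsLocalRing.eq_maximalIdeal (hJ.isMaximal_of_ne_bot hJ0)]
  obtain ⟨n, hn⟩ := hrad
  exact ⟨n, Ideal.mem_span_singleton.mp hn⟩

theorem ringKrullDim_eq_one_of_exists_dvd_pow (hR : ¬ IsField R)
    (h : ∀ a y : R, a ≠ 0 → y ∈ IsLocalRing.maximalIdeal R → ∃ n : ℕ, a ∣ y ^ n) :
    ringKrullDim R = 1 := by
  refine eq_of_le_of_not_lt (Ring.krullDimLE_iff (n := 1).mp ?_) fun hlt ↦ ?_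
  · refine Ring.KrullDimLE.mk₁' fun I hI0 hI ↦ ?_
    obtain ⟨a, haI, ha⟩ := Submodule.exists_mem_ne_zero_of_ne_bot hI0
    have hle : IsLocalRing.maximalIdeal R ≤ I := fun y hy ↦ by
      obtain ⟨n, hn⟩ := h a y ha hy
      exact hI.mem_of_pow_mem n (I.mem_of_dvd hn haI)
    rw [← (IsLocalRing.maximalIdeal.isMaximal R).eq_of_le hI.ne_top hle]
    infer_instance
  · have : Ring.KrullDimLE 0 R := Ring.krullDimLE_iff.mpr (ENat.WithBot.lt_add_one_iff.mp hlt)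
    exact hR Ring.KrullDimLE.isField_of_isDomain

end RankOne

theorem mem_one_iff_mem_range {D K : Type*} [CommRing D] [Field K] [Algebra D K] {x : K} :
    x ∈ (1 : FractionalIdeal D⁰ K) ↔ x ∈ (algebraMap D K).range :=
  FractionalIdeal.mem_one_iff _

/-! ### Elementwise `t`-ideals and maximal `t`-ideals -/

section TIdeals

variable {D : Type*} (K : Type*) [CommRing D] [IsDomain D] [Field K] [Algebra D K]
  [IsFractionRing D K]

/-- `a` lies in the `v`-closure of the nonzero integral ideal `F`. -/
def MemVClosure (F : Ideal D) (a : D) : Prop :=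
  ∀ x : K, (∀ f ∈ F, x * algebraMap D K f ∈ (algebraMap D K).range) →
    x * algebraMap D K a ∈ (algebraMap D K).range

variable {K} in
theorem mem_vClosure_iff {J : FractionalIdeal D⁰ K} (hJ : J ≠ 0) {x : K} :
    x ∈ vClosure J ↔ ∀ y : K, (∀ z ∈ J, y * z ∈ (algebraMap D K).range) →
      y * x ∈ (algebraMap D K).range := by
  rw [vClosure, FractionalIdeal.mem_inv_iff (inv_ne_zero_of_ne_zero hJ)]
  simp only [FractionalIdeal.mem_inv_iff hJ, mem_one_iff_mem_range, mul_comm x]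

theorem vClosure_zero : vClosure (0 : FractionalIdeal D⁰ K) = 0 := by
  simp [vClosure, FractionalIdeal.inv_eq]

theorem mem_vClosure_coeIdeal_iff {F : Ideal D} (hF : F ≠ ⊥) {a : D} :
    algebraMap D K a ∈ vClosure (F : FractionalIdeal D⁰ K) ↔ MemVClosure K F a := by
  rw [mem_vClosure_iff (FractionalIdeal.coeIdeal_ne_zero.mpr hF)]
  refine forall_congr' fun y ↦ imp_congr_left ⟨fun h f hf ↦ ?_, fun h z hz ↦ ?_⟩
  · exact h _ (FractionalIdeal.mem_coeIdeal_of_mem _ hf)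
  · obtain ⟨f, hf, rfl⟩ := (FractionalIdeal.mem_coeIdeal _).mp hz
    exact h f hf

theorem mem_tClosure_coeIdeal_iff {I : Ideal D} {x : K} :
    x ∈ tClosure (I : FractionalIdeal D⁰ K) ↔
      x = 0 ∨ ∃ F : Ideal D, F.FG ∧ F ≠ ⊥ ∧ F ≤ I ∧ ∃ a, MemVClosure K F a ∧
        algebraMap D K a = x := by
  constructor
  · rintro ⟨J, hJ, hJI, hx⟩
    obtain ⟨F, rfl⟩ := FractionalIdeal.le_one_iff_exists_coeIdeal.mp
      (hJI.trans FractionalIdeal.coeIdeal_le_one)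
    by_cases hF : F = ⊥
    · left
      subst hF
      rwa [FractionalIdeal.coeIdeal_bot, vClosure_zero, FractionalIdeal.mem_zero_iff] at hx
    · right
      -- Testing with the multiplier `1` shows `F_v ⊆ D`.
      have hx1 := (mem_vClosure_iff (FractionalIdeal.coeIdeal_ne_zero.mpr hF)).mp hx 1
        fun z hz ↦ by
          obtain ⟨f, hf, rfl⟩ := (FractionalIdeal.mem_coeIdeal _).mp hz
          exact ⟨f, by simp⟩
      obtain ⟨a, ha⟩ := hx1
      rw [one_mul] at ha
      subst ha
      refine ⟨F, ?_, hF, (FractionalIdeal.coeIdeal_le_coeIdeal K).mp hJI, a,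
        (mem_vClosure_coeIdeal_iff K hF).mp hx, rfl⟩
      exact (FractionalIdeal.coeIdeal_fg D⁰ (IsFractionRing.injective D K) F).mp hJ
  · rintro (rfl | ⟨F, hFG, hF, hFI, a, ha, rfl⟩)
    · exact Submodule.zero_mem (tClosure (I : FractionalIdeal D⁰ K)).1
    · exact ⟨F, (FractionalIdeal.coeIdeal_fg D⁰ (IsFractionRing.injective D K) F).mpr hFG,
        (FractionalIdeal.coeIdeal_le_coeIdeal K).mpr hFI,
        (mem_vClosure_coeIdeal_iff K hF).mpr ha⟩

theorem isTIdeal_iff {I : Ideal D} :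
    IsTIdeal K I ↔ I ≠ ⊥ ∧ ∀ F : Ideal D, F.FG → F ≠ ⊥ → F ≤ I → ∀ a, MemVClosure K F a →
      a ∈ I := by
  refine and_congr_right fun _ ↦ ⟨fun h F hFG hF hFI a ha ↦ ?_, fun h ↦ ?_⟩
  · have : algebraMap D K a ∈ tClosure (I : FractionalIdeal D⁰ K) :=
      (mem_tClosure_coeIdeal_iff K).mpr (.inr ⟨F, hFG, hF, hFI, a, ha, rfl⟩)
    rw [h] at this
    obtain ⟨b, hb, hba⟩ := (FractionalIdeal.mem_coeIdeal _).mp this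
    rwa [← IsFractionRing.injective D K hba]
  · refine le_antisymm (fun x hx ↦ ?_) fun x hx ↦ ?_
    · rcases (mem_tClosure_coeIdeal_iff K).mp hx with rfl | ⟨F, hFG, hF, hFI, a, ha, rfl⟩
      · exact Submodule.zero_mem (I : FractionalIdeal D⁰ K).1
      · exact FractionalIdeal.mem_coeIdeal_of_mem _ (h F hFG hF hFI a ha)
    · obtain ⟨a, ha, rfl⟩ := (FractionalIdeal.mem_coeIdeal _).mp hx
      by_cases ha0 : a = 0
      · exact (mem_tClosure_coeIdeal_iff K).mpr (.inl (by simp [ha0]))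
      · refine (mem_tClosure_coeIdeal_iff K).mpr (.inr ⟨Ideal.span {a}, ⟨{a}, by simp⟩, by simpa,
          by simpa [Ideal.span_le], a, fun y hy ↦ hy a (Ideal.mem_span_singleton_self a), rfl⟩)

variable {K}

theorem IsTIdeal.mem {I F : Ideal D} (hI : IsTIdeal K I) (hFG : F.FG) (hF : F ≠ ⊥) (hFI : F ≤ I)
    {a : D} (ha : MemVClosure K F a) : a ∈ I :=
  ((isTIdeal_iff K).mp hI).2 F hFG hF hFI a ha

/-- If `1` lies in the `t`-closure of an integral ideal, the ideal is in no proper `t`-ideal. -/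
theorem IsTIdeal.not_le_of_tClosure_eq_one {I : Ideal D} (hI : IsTIdeal K I) (hI1 : I ≠ ⊤)
    {A : Ideal D} (hA : tClosure (A : FractionalIdeal D⁰ K) = 1) : ¬ A ≤ I := by
  intro hAI
  have h1 : (1 : K) ∈ tClosure (A : FractionalIdeal D⁰ K) := by
    rw [hA]
    exact FractionalIdeal.one_mem_one _
  rcases (mem_tClosure_coeIdeal_iff K).mp h1 with h | ⟨F, hFG, hF, hFA, a, ha, ha1⟩
  · exact one_ne_zero h
  · rw [map_eq_one_iff _ (IsFractionRing.injective D K)] at ha1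
    subst ha1
    exact hI1 ((Ideal.eq_top_iff_one I).mpr (hI.mem hFG hF (hFA.trans hAI) ha))

theorem IsTIdeal.colon {I : Ideal D} (hI : IsTIdeal K I) (S : Set D) :
    IsTIdeal K (I.colon S) := by
  refine (isTIdeal_iff K).mpr ⟨fun h ↦ hI.1 (le_bot_iff.mp (h ▸ Ideal.le_colon)), ?_⟩
  intro F hFG hF hFI a ha
  refine Submodule.mem_colon.mpr fun s hs ↦ ?_
  by_cases hs0 : s = 0
  · simp [hs0]
  refine hI.mem (F := Ideal.span {s} * F) ((Submodule.fg_span_singleton s).mul hFG)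
    (mul_ne_zero (by simpa using hs0) hF) ?_ fun x hx ↦ ?_
  · rw [Ideal.span_singleton_mul_le_iff]
    intro f hf
    simpa [mul_comm] using Submodule.mem_colon.mp (hFI hf) s hs
  · have := ha (x * algebraMap D K s) fun f hf ↦ by
      have := hx (s * f) (Ideal.mul_mem_mul (Ideal.mem_span_singleton_self s) hf)
      rwa [map_mul, ← mul_assoc] at this
    rwa [smul_eq_mul, mul_comm a, map_mul, ← mul_assoc]

theorem isTIdeal_span_singleton {d : D} (hd : d ≠ 0) : IsTIdeal K (Ideal.span {d}) := by
  refine (isTIdeal_iff K).mpr ⟨by simpa, fun F _ _ hFI a ha ↦ ?_⟩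
  have hd' : algebraMap D K d ≠ 0 := by simpa
  obtain ⟨b, hb⟩ := ha (algebraMap D K d)⁻¹ fun f hf ↦ by
    obtain ⟨c, rfl⟩ := Ideal.mem_span_singleton.mp (hFI hf)
    exact ⟨c, by rw [map_mul, inv_mul_cancel_left₀ hd']⟩
  rw [Ideal.mem_span_singleton]
  refine ⟨b, IsFractionRing.injective D K ?_⟩
  rw [map_mul, hb, mul_inv_cancel_left₀ hd']

variable (D) in
/-- The ideal of denominators of `x`. -/
def denomIdeal (x : K) : Ideal D where
  carrier := {r | algebraMap D K r * x ∈ (algebraMap D K).range}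
  zero_mem' := ⟨0, by simp⟩
  add_mem' {a b} ha hb := by
    have := (algebraMap D K).range.add_mem ha hb
    rwa [← add_mul, ← map_add] at this
  smul_mem' c a ha := by
    have := (algebraMap D K).range.mul_mem (RingHom.mem_range_self _ c) ha
    rwa [← mul_assoc, ← map_mul] at this

theorem isTIdeal_denomIdeal (x : K) : IsTIdeal K (denomIdeal D x) := by
  refine (isTIdeal_iff K).mpr ⟨fun h ↦ ?_, fun F _ _ hFI a ha ↦ ?_⟩
  · obtain ⟨a, s, hs, rfl⟩ := IsFractionRing.div_surjective (A := D) x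
    have hs0 := nonZeroDivisors.ne_zero hs
    have hmem : s ∈ denomIdeal D (algebraMap D K a / algebraMap D K s) :=
      ⟨a, by rw [mul_div_cancel₀]; simpa⟩
    rw [h] at hmem
    exact hs0 hmem
  · have := ha x fun f hf ↦ by
      rw [mul_comm]
      exact hFI hf
    rwa [mul_comm] at this

/-- A `t`-ideal containing no member of a set of finitely generated ideals is contained in
a `t`-ideal maximal with this property. -/
theorem IsTIdeal.exists_le_maximal {I : Ideal D} (hI : IsTIdeal K I) {𝒮 : Set (Ideal D)}
    (h𝒮 : ∀ A ∈ 𝒮, A.FG) (hI𝒮 : ∀ A ∈ 𝒮, ¬ A ≤ I) :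
    ∃ M, I ≤ M ∧ Maximal (fun M : Ideal D ↦ IsTIdeal K M ∧ ∀ A ∈ 𝒮, ¬ A ≤ M) M := by
  refine zorn_le_nonempty₀ {M : Ideal D | IsTIdeal K M ∧ ∀ A ∈ 𝒮, ¬ A ≤ M} ?_ I ⟨hI, hI𝒮⟩
  intro c hc hchain M hM
  -- Finitely generated ideals are compact, so `t`-ideals and the avoidance condition pass to unions
  -- of chains.
  have key : ∀ F : Ideal D, F.FG → F ≤ sSup c → ∃ N ∈ c, F ≤ N := fun F hF hle ↦
    (CompleteLattice.isCompactElement_iff_le_of_directed_sSup_le _ F).mp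
      ((Submodule.fg_iff_compact F).mp hF) c ⟨M, hM⟩ hchain.directedOn hle
  refine ⟨sSup c, ⟨(isTIdeal_iff K).mpr ⟨fun h ↦ ?_, fun F hFG hF hFI a ha ↦ ?_⟩,
    fun A hA hle ↦ ?_⟩, fun N hN ↦ le_sSup hN⟩
  · exact (hc hM).1.1 (le_bot_iff.mp (h ▸ le_sSup hM))
  · obtain ⟨N, hN, hFN⟩ := key F hFG hFI
    exact le_sSup hN ((hc hN).1.mem hFG hF hFN ha)
  · obtain ⟨N, hN, hAN⟩ := key A (h𝒮 A hA) hle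
    exact (hc hN).2 A hA hAN

/-- Colons of `M` are `t`-ideals, so one strictly larger than `M` contains a member of `𝒮`. If `xy ∈
M` with `x, y ∉ M`, this applies to `M : x`, giving `A`, then to `M : A`, giving `B` with `AB ≤ M`.
-/
theorem IsTIdeal.isPrime_of_maximal {M : Ideal D} {𝒮 : Set (Ideal D)} (htop : ⊤ ∈ 𝒮)
    (hmul : ∀ A ∈ 𝒮, ∀ B ∈ 𝒮, A * B ∈ 𝒮)
    (hM : Maximal (fun M : Ideal D ↦ IsTIdeal K M ∧ ∀ A ∈ 𝒮, ¬ A ≤ M) M) : M.IsPrime := by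
  have aux : ∀ S : Set D, ∀ x ∈ M.colon S, x ∉ M → ∃ A ∈ 𝒮, A ≤ M.colon S := by
    intro S x hx hxM
    by_contra! h
    exact hxM (hM.2 ⟨hM.1.1.colon S, h⟩ Ideal.le_colon hx)
  refine ⟨fun h ↦ hM.1.2 ⊤ htop h.ge, fun {x y} hxy ↦ ?_⟩
  by_contra! h
  obtain ⟨A, hA, hAM⟩ := aux {x} y (by simpa [mul_comm] using hxy) h.2
  obtain ⟨B, hB, hBM⟩ := aux (A : Set D) x (Submodule.mem_colon.mpr fun a ha ↦ by
    simpa [mul_comm] using hAM ha) h.1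
  refine hM.1.2 _ (hmul A hA B hB) (Ideal.mul_le.mpr fun a ha b hb ↦ ?_)
  simpa [mul_comm] using Submodule.mem_colon.mp (hBM hb) a ha

theorem maximal_iff_isMaximalTIdeal {P : Ideal D} :
    Maximal (fun M : Ideal D ↦ IsTIdeal K M ∧ ∀ A ∈ ({⊤} : Set (Ideal D)), ¬ A ≤ M) P ↔
      IsMaximalTIdeal K P := by
  simp only [IsMaximalTIdeal, Set.mem_singleton_iff, forall_eq, top_le_iff, ne_eq]

theorem IsTIdeal.exists_le_isMaximalTIdeal {I : Ideal D} (hI : IsTIdeal K I) (hI1 : I ≠ ⊤) :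
    ∃ P, I ≤ P ∧ IsMaximalTIdeal K P := by
  simp only [← maximal_iff_isMaximalTIdeal]
  refine hI.exists_le_maximal ?_ ?_
  · rintro A rfl
    exact ⟨{1}, by simp⟩
  · rintro A rfl
    rwa [top_le_iff]

theorem IsMaximalTIdeal.isPrime {P : Ideal D} (hP : IsMaximalTIdeal K P) : P.IsPrime :=
  IsTIdeal.isPrime_of_maximal (𝒮 := {⊤}) rfl (by rintro _ rfl _ rfl; simp)
    (maximal_iff_isMaximalTIdeal.mpr hP)

theorem IsMaximalTIdeal.ne_bot {P : Ideal D} (hP : IsMaximalTIdeal K P) : P ≠ ⊥ := hP.1.1.1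

theorem IsMaximalTIdeal.eq_of_le {P Q : Ideal D} (hP : IsMaximalTIdeal K P)
    (hQ : IsMaximalTIdeal K Q) (h : P ≤ Q) : P = Q :=
  le_antisymm h (hP.2 hQ.1 h)

end TIdeals

theorem ne_zero_of_notMem {D K : Type*} [CommRing D] [Field K] [Algebra D K] [IsFractionRing D K]
    {P : Ideal D} {s : D} (hs : s ∉ P) : algebraMap D K s ≠ 0 := by
  have : s ≠ 0 := fun h ↦ hs (h ▸ P.zero_mem)
  simpa

/-! ### Valuation rings that are localizations of `D` -/

section LocalizationAt

variable {D K : Type*} [CommRing D] [Field K] [Algebra D K]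

/-- `V` is the localization of `D` at the prime `P`, as a subring of `K`. -/
def IsLocalizationAt (V : ValuationSubring K) (P : Ideal D) : Prop :=
  ∀ x, x ∈ V ↔ ∃ a s : D, s ∉ P ∧ x = algebraMap D K a * (algebraMap D K s)⁻¹

theorem IsLocalizationAt.algebraMap_mem {V : ValuationSubring K} {P : Ideal D}
    (h : IsLocalizationAt V P) [P.IsPrime] (d : D) :
    algebraMap D K d ∈ V :=
  (h _).mpr ⟨d, 1, Ideal.one_notMem P, by simp⟩

theorem IsLocalizationAt.inv_mem {V : ValuationSubring K} {P : Ideal D}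
    (h : IsLocalizationAt V P) {s : D} (hs : s ∉ P) : (algebraMap D K s)⁻¹ ∈ V :=
  (h _).mpr ⟨1, s, hs, by simp⟩

theorem IsLocalizationAt.algebraMap_mem_nonunits [IsFractionRing D K]
    {V : ValuationSubring K} {P : Ideal D} (h : IsLocalizationAt V P)
    [P.IsPrime] {d : D} :
    algebraMap D K d ∈ V.nonunits ↔ d ∈ P := by
  by_cases hd : d = 0
  · simp [hd, V.nonunits.zero_mem]
  have hd' : algebraMap D K d ≠ 0 := by simpa
  rw [ValuationSubring.mem_nonunits_iff_or, or_iff_right hd', not_iff_comm]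
  refine ⟨h.inv_mem, fun hmem hdP ↦ ?_⟩
  obtain ⟨a, s, hs, hx⟩ := (h _).mp hmem
  have hs' : algebraMap D K s ≠ 0 := ne_zero_of_notMem hs
  have : s = d * a := IsFractionRing.injective D K <| by
    rw [map_mul]
    field_simp at hx
    exact hx
  exact hs (this ▸ P.mul_mem_right a hdP)

end LocalizationAt

section Localizations

variable {D K : Type*} [CommRing D] [Field K] [Algebra D K] [IsFractionRing D K]

theorem isEssential_iff [IsDomain D] {V : ValuationSubring K} :
    IsEssential D V ↔ ∃ P : Ideal D, P.IsPrime ∧ IsLocalizationAt V P := by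
  constructor
  · rintro ⟨P, hP, h⟩
    refine ⟨P, hP, fun x ↦ ?_⟩
    rw [← SetLike.mem_coe, h]
    exact ⟨fun ⟨a, s, hs, hx⟩ ↦ ⟨a, s, hs, hx⟩, fun ⟨a, s, hs, hx⟩ ↦ ⟨a, s, hs, hx⟩⟩
  · rintro ⟨P, hP, h⟩
    refine ⟨P, hP, Set.ext fun x ↦ (h x).trans ?_⟩
    exact ⟨fun ⟨a, s, hs, hx⟩ ↦ ⟨a, s, hs, hx⟩, fun ⟨a, s, hs, hx⟩ ↦ ⟨a, s, hs, hx⟩⟩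

theorem exists_pow_mul_inv_mem {V : ValuationSubring K} (hV : ringKrullDim V = 1) {a y : K}
    (ha : a ∈ V) (ha0 : a ≠ 0) (hy : y ∈ V.nonunits) : ∃ n : ℕ, y ^ n * a⁻¹ ∈ V := by
  obtain ⟨n, c, hc⟩ := exists_dvd_pow_of_ringKrullDim_eq_one hV (a := ⟨a, ha⟩)
    (y := ⟨y, ValuationSubring.nonunits_subset hy⟩) (fun h ↦ ha0 (congrArg Subtype.val h))
    (ValuationSubring.coe_mem_nonunits_iff.mp hy)
  have hc' : y ^ n = a * c := congrArg Subtype.val hc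
  refine ⟨n, ?_⟩
  rw [hc', mul_comm a, mul_inv_cancel_right₀ ha0]
  exact c.2

theorem ringKrullDim_eq_one_of_exists_pow_mul_inv_mem {V : ValuationSubring K} {d : K}
    (hd : d ∈ V.nonunits) (hd0 : d ≠ 0)
    (h : ∀ a y : K, a ∈ V → a ≠ 0 → y ∈ V.nonunits → ∃ n : ℕ, y ^ n * a⁻¹ ∈ V) :
    ringKrullDim V = 1 := by
  refine ringKrullDim_eq_one_of_exists_dvd_pow (fun hf ↦ ?_) fun a y ha hy ↦ ?_
  · have hdm := ValuationSubring.coe_mem_nonunits_iff.mp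
      (show ((⟨d, ValuationSubring.nonunits_subset hd⟩ : V) : K) ∈ V.nonunits from hd)
    rw [IsLocalRing.isField_iff_maximalIdeal_eq.mp hf] at hdm
    exact hd0 (congrArg Subtype.val hdm)
  · have ha0 : (a : K) ≠ 0 := fun h0 ↦ ha (Subtype.ext h0)
    obtain ⟨n, hn⟩ := h a y a.2 ha0 (ValuationSubring.coe_mem_nonunits_iff.mpr hy)
    refine ⟨n, ⟨_, hn⟩, Subtype.ext ?_⟩
    change (y : K) ^ n = a * (y ^ n * (a : K)⁻¹)
    field_simp

theorem IsLocalizationAt.le_of_ringKrullDim_eq_one {V : ValuationSubring K} {P Q : Ideal D}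
    [P.IsPrime] (h : IsLocalizationAt V P) (hV : ringKrullDim V = 1) [hQ : Q.IsPrime]
    (hQ0 : Q ≠ ⊥) (hQP : Q ≤ P) : P ≤ Q := by
  intro y hy
  obtain ⟨a, haQ, ha⟩ := Submodule.exists_mem_ne_zero_of_ne_bot hQ0
  have ha' : algebraMap D K a ≠ 0 := by simpa
  obtain ⟨n, hn⟩ := exists_pow_mul_inv_mem hV (h.algebraMap_mem a) ha'
    (h.algebraMap_mem_nonunits.mpr hy)
  obtain ⟨c, s, hs, hx⟩ := (h _).mp hn
  have hs' : algebraMap D K s ≠ 0 := ne_zero_of_notMem hs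
  have : y ^ n * s = a * c := IsFractionRing.injective D K <| by
    simp only [map_mul, map_pow]
    field_simp at hx
    exact hx
  refine hQ.mem_of_pow_mem n ((hQ.mem_or_mem ?_).resolve_right fun hsQ ↦ hs (hQP hsQ))
  exact this ▸ Q.mul_mem_right c haQ

theorem IsLocalizationAt.prime_unique {V : ValuationSubring K} {P Q : Ideal D} [P.IsPrime]
    [Q.IsPrime] (hP : IsLocalizationAt V P) (hQ : IsLocalizationAt V Q) : P = Q :=
  Ideal.ext fun _ ↦ hP.algebraMap_mem_nonunits.symm.trans hQ.algebraMap_mem_nonunits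

/-- The denominators of `x` form a `t`-ideal; were it proper, it would lie in some maximal `t`-ideal
`P`, yet `x` has a denominator outside `P`. -/
theorem mem_range_of_forall_isMaximalTIdeal [IsDomain D] {x : K}
    (h : ∀ P : Ideal D, IsMaximalTIdeal K P →
      ∃ a s : D, s ∉ P ∧ x = algebraMap D K a * (algebraMap D K s)⁻¹) :
    x ∈ (algebraMap D K).range := by
  by_cases htop : denomIdeal D x = ⊤
  · have : (1 : D) ∈ denomIdeal D x := htop ▸ Submodule.mem_top
    simpa [denomIdeal] using this
  · obtain ⟨P, hP, hPm⟩ := (isTIdeal_denomIdeal x).exists_le_isMaximalTIdeal htop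
    obtain ⟨a, s, hs, rfl⟩ := h P hPm
    refine absurd (hP ⟨a, ?_⟩) hs
    have hs' : algebraMap D K s ≠ 0 := ne_zero_of_notMem hs
    field_simp

theorem IsPVMD.exists_isLocalizationAt [IsDomain D] (hD : IsPVMD D K) {P : Ideal D}
    (hP : IsMaximalTIdeal K P) : ∃ V : ValuationSubring K, IsLocalizationAt V P := by
  have hprime := hP.isPrime
  let B := Localization.subalgebra.ofField K P.primeCompl P.primeCompl_le_nonZeroDivisors
  have hB : ∀ x, x ∈ B ↔ ∃ a s : D, s ∉ P ∧ x = algebraMap D K a * (algebraMap D K s)⁻¹ := fun x ↦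
    ⟨fun ⟨a, s, hs, hx⟩ ↦ ⟨a, s, hs, hx⟩, fun ⟨a, s, hs, hx⟩ ↦ ⟨a, s, hs, hx⟩⟩
  refine ⟨⟨B.toSubring, fun x ↦ ?_⟩, hB⟩
  change x ∈ B ∨ x⁻¹ ∈ B
  obtain ⟨a, b, hb, rfl⟩ := IsFractionRing.div_surjective (A := D) x
  have hb0 := nonZeroDivisors.ne_zero hb
  have hb' : algebraMap D K b ≠ 0 := by simpa
  set F : Ideal D := Ideal.span {a, b} with hF
  have haF : a ∈ F := Ideal.subset_span (by simp)
  have hbF : b ∈ F := Ideal.subset_span (by simp)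
  have hF0 : (F : FractionalIdeal D⁰ K) ≠ 0 :=
    FractionalIdeal.coeIdeal_ne_zero.mpr fun h ↦ hb0 (by simpa [h] using hbF)
  have hFfg : ((F : FractionalIdeal D⁰ K) : Submodule D K).FG :=
    (FractionalIdeal.coeIdeal_fg D⁰ (IsFractionRing.injective D K) F).mpr
      (Submodule.fg_span (by simp))
  have htc := hD F hF0 hFfg
  obtain ⟨A, hA⟩ := FractionalIdeal.le_one_iff_exists_coeIdeal.mp
    (show (F : FractionalIdeal D⁰ K) * (F : FractionalIdeal D⁰ K)⁻¹ ≤ 1 by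
      rw [FractionalIdeal.inv_eq]
      exact FractionalIdeal.mul_one_div_le_one)
  rw [← hA] at htc
  have hAP := hP.1.1.not_le_of_tClosure_eq_one hP.1.2 htc
  -- Since `F F⁻¹ ⊄ P`, some multiple `(c, e)` of `(a, b)` has an entry outside `P`, and `a / b = c
  -- / e`.
  obtain ⟨y, hy, hyP⟩ : ∃ y ∈ (F : FractionalIdeal D⁰ K)⁻¹, ∃ c e : D,
      algebraMap D K c = y * algebraMap D K a ∧ algebraMap D K e = y * algebraMap D K b ∧
        (c ∉ P ∨ e ∉ P) := by
    by_contra! hcon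
    refine hAP ((FractionalIdeal.coeIdeal_le_coeIdeal K).mp ?_)
    rw [hA, FractionalIdeal.mul_le]
    intro i hi y hy
    obtain ⟨f, hf, rfl⟩ := (FractionalIdeal.mem_coeIdeal _).mp hi
    have hyF := (FractionalIdeal.mem_inv_iff hF0).mp hy
    obtain ⟨c, hc⟩ := mem_one_iff_mem_range.mp (hyF _ (FractionalIdeal.mem_coeIdeal_of_mem _ haF))
    obtain ⟨e, he⟩ := mem_one_iff_mem_range.mp (hyF _ (FractionalIdeal.mem_coeIdeal_of_mem _ hbF))
    obtain ⟨hcP, heP⟩ := hcon y hy c e hc he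
    obtain ⟨r, s, rfl⟩ := Ideal.mem_span_pair.mp hf
    refine (FractionalIdeal.mem_coeIdeal _).mpr
      ⟨r * c + s * e, P.add_mem (P.mul_mem_left _ hcP) (P.mul_mem_left _ heP), ?_⟩
    simp only [map_add, map_mul, hc, he]
    ring
  obtain ⟨c, e, hc, he, hcP | heP⟩ := hyP
  · right
    have hc' : algebraMap D K c ≠ 0 := ne_zero_of_notMem hcP
    have hy0 : y ≠ 0 := fun h ↦ hc' (by simp [hc, h])
    refine (hB _).mpr ⟨e, c, hcP, ?_⟩
    rw [hc, he, inv_div, ← div_eq_mul_inv, mul_div_mul_left _ _ hy0]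
  · left
    have he' : algebraMap D K e ≠ 0 := ne_zero_of_notMem heP
    have hy0 : y ≠ 0 := fun h ↦ he' (by simp [he, h])
    refine (hB _).mpr ⟨c, e, heP, ?_⟩
    rw [hc, he, ← div_eq_mul_inv, mul_div_mul_left _ _ hy0]

end Localizations

/-! ### The two implications -/

section GeneralizedKrull

variable {D K : Type*} [CommRing D] [IsDomain D] [Field K] [Algebra D K] [IsFractionRing D K]

theorem IsGeneralizedKrull.isCompletelyIntegrallyClosed (h : IsGeneralizedKrull D K) :
    IsCompletelyIntegrallyClosed D K := by
  obtain ⟨𝒱, h𝒱, hmem, -⟩ := h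
  refine eq_bot_iff.mpr fun x ⟨r, hr, hx⟩ ↦ Algebra.mem_bot.mpr ?_
  refine (hmem x).mpr fun V hV ↦ ?_
  by_contra hxV
  have hr0 : algebraMap D K r ≠ 0 := by simpa using nonZeroDivisors.ne_zero hr
  have hx0 : x ≠ 0 := fun h ↦ hxV (h ▸ V.zero_mem)
  -- As `x⁻¹` is a nonunit, `x⁻ⁿ / r ∈ V` for some `n`; the factor `r xⁿ⁺¹ ∈ D` then leaves exactly
  -- `x`.
  obtain ⟨n, hn⟩ := exists_pow_mul_inv_mem (h𝒱 V hV).2 ((hmem _).mp ⟨r, rfl⟩ V hV) hr0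
    (V.inv_mem_nonunits_iff.mpr (.inr hxV))
  refine hxV ?_
  convert! V.mul_mem _ _ hn ((hmem _).mp (hx (n + 1)) V hV) using 1
  rw [Algebra.smul_def, inv_pow, pow_succ]
  field_simp

/-- In a generalized Krull domain, every maximal `t`-ideal is the center of a member of the
defining family. -/
theorem exists_isLocalizationAt_of_mem {𝒱 : Set (ValuationSubring K)}
    (h𝒱 : ∀ V ∈ 𝒱, IsEssential D V ∧ ringKrullDim V = 1)
    (hmem : ∀ x : K, x ∈ (algebraMap D K).range ↔ ∀ V ∈ 𝒱, x ∈ V)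
    {d : D} (hd : d ≠ 0) (hfin : {V ∈ 𝒱 | algebraMap D K d ∈ V.nonunits}.Finite)
    {Q : Ideal D} (hQ : IsMaximalTIdeal K Q) (hdQ : d ∈ Q) :
    ∃ V ∈ {V ∈ 𝒱 | algebraMap D K d ∈ V.nonunits}, IsLocalizationAt V Q := by
  have hQprime := hQ.isPrime
  choose! p hp using fun V hV ↦ isEssential_iff.mp (h𝒱 V hV).1
  obtain ⟨V, hV, hQV⟩ : ∃ V ∈ {V ∈ 𝒱 | algebraMap D K d ∈ V.nonunits}, Q ≤ p V := by
    by_contra! hcon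
    obtain ⟨e, heQ, he⟩ : ∃ e ∈ Q, ∀ V ∈ {V ∈ 𝒱 | algebraMap D K d ∈ V.nonunits}, e ∉ p V := by
      by_contra! hcov
      -- Prime avoidance; `⊤ ⊤` fill the slots for indices exempt from primality, of which none is
      -- needed.
      obtain ⟨V, hV, hle⟩ := (Ideal.subset_union_prime_finite hfin (f := p) ⊤ ⊤
        fun V hV _ _ ↦ (hp V hV.1).1).mp fun e he ↦ by simpa using hcov e he
      exact hcon V hV hle
    -- `(d, e)_v = D`: in each `V` either `d` or `e` is a unit.
    refine hQ.1.2 ((Ideal.eq_top_iff_one Q).mpr (hQ.1.1.mem (F := Ideal.span {d, e})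
      (Submodule.fg_span (by simp)) (fun h ↦ hd ?_) (Ideal.span_le.mpr ?_) fun x hx ↦ ?_))
    · simpa [h] using (Ideal.subset_span (by simp) : d ∈ Ideal.span {d, e})
    · simp [Set.insert_subset_iff, hdQ, heQ]
    · rw [map_one, mul_one, hmem]
      intro V hV
      by_cases hdV : algebraMap D K d ∈ V.nonunits
      · have := V.mul_mem _ _ ((hmem _).mp (hx e (Ideal.subset_span (by simp))) V hV)
          ((hp V hV).2.inv_mem (he V ⟨hV, hdV⟩))
        rwa [mul_inv_cancel_right₀ (ne_zero_of_notMem (he V ⟨hV, hdV⟩))] at this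
      · have hdV' := hdV
        rw [ValuationSubring.mem_nonunits_iff_or] at hdV'
        push Not at hdV'
        have := V.mul_mem _ _ ((hmem _).mp (hx d (Ideal.subset_span (by simp))) V hV) hdV'.2
        rwa [mul_inv_cancel_right₀ hdV'.1] at this
  have := (hp V hV.1).1
  have hPQ := (hp V hV.1).2.le_of_ringKrullDim_eq_one (h𝒱 V hV.1).2 hQ.ne_bot hQV
  exact ⟨V, hV, le_antisymm hQV hPQ ▸ (hp V hV.1).2⟩

theorem IsGeneralizedKrull.finite_isMaximalTIdeal (h : IsGeneralizedKrull D K) {d : D}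
    (hd : d ≠ 0) : {Q : Ideal D | IsMaximalTIdeal K Q ∧ d ∈ Q}.Finite := by
  obtain ⟨𝒱, h𝒱, hmem, hfin⟩ := h
  refine ((hfin d hd).biUnion (t := fun V ↦ {Q | Q.IsPrime ∧ IsLocalizationAt V Q})
    fun V _ ↦ Set.Subsingleton.finite ?_).subset fun Q ⟨hQ, hdQ⟩ ↦ ?_
  · rintro P ⟨_, hP⟩ Q ⟨_, hQ⟩
    exact hP.prime_unique hQ
  · obtain ⟨V, hV, hVQ⟩ := exists_isLocalizationAt_of_mem h𝒱 hmem hd (hfin d hd) hQ hdQ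
    exact Set.mem_biUnion hV ⟨hQ.isPrime, hVQ⟩

theorem IsMaximalTIdeal.isPotent_of_finite {P : Ideal D} (hP : IsMaximalTIdeal K P) {d : D}
    (hd : d ≠ 0) (hdP : d ∈ P) (hfin : {Q : Ideal D | IsMaximalTIdeal K Q ∧ d ∈ Q}.Finite) :
    IsPotent K P := by
  obtain ⟨e, heP, he⟩ : ∃ e ∈ P, ∀ Q ∈ {Q : Ideal D | IsMaximalTIdeal K Q ∧ d ∈ Q} \ {P},
      e ∉ Q := by
    by_contra! hcov
    obtain ⟨Q, hQ, hle⟩ := (Ideal.subset_union_prime_finite (hfin.sdiff (t := {P})) (f := id) ⊤ ⊤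
      fun Q hQ _ _ ↦ hQ.1.1.isPrime).mp fun e he ↦ by simpa using hcov e he
    exact hQ.2 (hP.eq_of_le hQ.1.1 hle).symm
  have hdF : d ∈ Ideal.span {d, e} := Ideal.subset_span (by simp)
  have heF : e ∈ Ideal.span {d, e} := Ideal.subset_span (by simp)
  refine ⟨Ideal.span {d, e}, fun h ↦ hd (by simpa [h] using hdF), Submodule.fg_span (by simp),
    Ideal.span_le.mpr (by simp [Set.insert_subset_iff, hdP, heP]), fun Q hQ hle ↦ ?_⟩
  by_contra hne
  exact he Q ⟨⟨hQ, hle hdF⟩, hne⟩ (hle heF)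

theorem IsGeneralizedKrull.isPotent (h : IsGeneralizedKrull D K) {P : Ideal D}
    (hP : IsMaximalTIdeal K P) : IsPotent K P := by
  obtain ⟨d, hdP, hd⟩ := Submodule.exists_mem_ne_zero_of_ne_bot hP.ne_bot
  exact hP.isPotent_of_finite hd hdP (h.finite_isMaximalTIdeal hd)

theorem IsPotent.ringKrullDim_eq_one (hcic : IsCompletelyIntegrallyClosed D K) {P : Ideal D}
    (hpot : IsPotent K P) (hP : IsMaximalTIdeal K P) {V : ValuationSubring K}
    (hV : IsLocalizationAt V P) : ringKrullDim V = 1 := by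
  have hprime := hP.isPrime
  obtain ⟨d, hdP, hd⟩ := Submodule.exists_mem_ne_zero_of_ne_bot hP.ne_bot
  refine ringKrullDim_eq_one_of_exists_pow_mul_inv_mem (hV.algebraMap_mem_nonunits.mpr hdP)
    (by simpa) fun a y ha ha0 hy ↦ ?_
  by_contra! hcon
  -- The exponent must be positive, as `0 ^ 0 = 1`.
  have hy0 : y ≠ 0 := fun h ↦ hcon 1 (by simp [h, V.zero_mem])
  have hdiv : ∀ n : ℕ, a * (y ^ n)⁻¹ ∈ V := fun n ↦ by
    have := (V.mem_or_inv_mem (y ^ n * a⁻¹)).resolve_left (hcon n)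
    rwa [mul_inv, inv_inv, mul_comm] at this
  obtain ⟨a', t, ht, hat⟩ := (hV a).mp ha
  obtain ⟨b, s, hs, hys⟩ := (hV y).mp (ValuationSubring.nonunits_subset hy)
  have ht0 : algebraMap D K t ≠ 0 := ne_zero_of_notMem ht
  have hs0 : algebraMap D K s ≠ 0 := ne_zero_of_notMem hs
  have ha' : algebraMap D K a' = a * algebraMap D K t := by
    rw [hat, inv_mul_cancel_right₀ ht0]
  have hb : algebraMap D K b = y * algebraMap D K s := by
    rw [hys, inv_mul_cancel_right₀ hs0]
  have hbP : b ∈ P := by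
    rw [← hV.algebraMap_mem_nonunits, hb, ValuationSubring.mem_nonunits_iff, map_mul]
    exact mul_lt_one_of_lt_of_le (V.mem_nonunits_iff.mp hy)
      ((V.valuation_le_one_iff _).mpr (hV.algebraMap_mem s))
  obtain ⟨J, hJ0, hJfg, hJP, hJ⟩ := hpot
  refine hP.1.2 ((Ideal.eq_top_iff_one P).mpr (hP.1.1.mem (F := J ⊔ Ideal.span {b})
    (Submodule.FG.sup hJfg (Submodule.fg_span_singleton b)) (ne_bot_of_le_ne_bot hJ0 le_sup_left)
    (sup_le hJP (by simpa [Ideal.span_le])) fun x hx ↦ ?_))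
  have hxb := hx b (Ideal.mem_sup_right (Ideal.mem_span_singleton_self b))
  have hxJ := fun j (hj : j ∈ J) ↦ hx j (Ideal.mem_sup_left hj)
  have hxy : x * y ∈ V := by
    obtain ⟨c, hc⟩ := hxb
    refine (hV _).mpr ⟨c, s, hs, ?_⟩
    rw [hc, hb, ← mul_assoc, mul_inv_cancel_right₀ hs0]
  have hx : x ∈ completeIntegralClosure D K := by
    have ha0' : a' ≠ 0 := by
      rintro rfl
      exact mul_ne_zero ha0 ht0 (by simpa using ha'.symm)
    refine ⟨a', mem_nonZeroDivisors_of_ne_zero ha0', fun n ↦ ?_⟩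
    refine mem_range_of_forall_isMaximalTIdeal fun Q hQ ↦ ?_
    -- At `P`, `a' xⁿ = t (a / yⁿ) (xy)ⁿ`; at any other `Q`, `x` itself lies in `D_Q` because `J ⊄
    -- Q`.
    by_cases hQP : Q = P
    · subst hQP
      refine (hV _).mp ?_
      convert! V.mul_mem _ _ (V.mul_mem _ _ (hV.algebraMap_mem t) (hdiv n))
        (pow_mem hxy n) using 1
      rw [Algebra.smul_def, ha', mul_pow]
      field_simp
    · obtain ⟨j, hjJ, hjQ⟩ := SetLike.not_le_iff_exists.mp fun h ↦ hQP (hJ Q hQ h)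
      obtain ⟨c, hc⟩ := hxJ j hjJ
      have hj0 : algebraMap D K j ≠ 0 := ne_zero_of_notMem hjQ
      refine ⟨a' * c ^ n, j ^ n, fun h ↦ hjQ (hQ.isPrime.mem_of_pow_mem n h), ?_⟩
      rw [Algebra.smul_def, map_mul, map_pow, map_pow, hc, mul_pow]
      field_simp
  rw [hcic] at hx
  simpa using Algebra.mem_bot.mp hx

theorem IsPVMD.finite_isMaximalTIdeal (hD : IsPVMD D K)
    (hcic : IsCompletelyIntegrallyClosed D K)
    (hpot : ∀ P : Ideal D, IsMaximalTIdeal K P → IsPotent K P) {d : D} (hd : d ≠ 0) :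
    {Q : Ideal D | IsMaximalTIdeal K Q ∧ d ∈ Q}.Finite := by
  let 𝒮 : Set (Ideal D) := {A | A.FG ∧ {Q : Ideal D | IsMaximalTIdeal K Q ∧ A ≤ Q}.Finite}
  have htop : ⊤ ∈ 𝒮 := ⟨⟨{1}, by simp⟩, Set.finite_empty.subset fun Q ⟨hQ, hle⟩ ↦
    hQ.1.2 (top_le_iff.mp hle)⟩
  -- A prime containing `A * B` contains `A` or `B`.
  have hmul : ∀ A ∈ 𝒮, ∀ B ∈ 𝒮, A * B ∈ 𝒮 := fun A hA B hB ↦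
    ⟨hA.1.mul hB.1, (hA.2.union hB.2).subset fun Q ⟨hQ, hle⟩ ↦
      (hQ.isPrime.mul_le.mp hle).imp (⟨hQ, ·⟩) (⟨hQ, ·⟩)⟩
  by_contra hinf
  obtain ⟨M, -, hM⟩ := (isTIdeal_span_singleton (K := K) hd).exists_le_maximal (𝒮 := 𝒮)
    (fun A hA ↦ hA.1) fun A hA hle ↦ hinf (hA.2.subset fun Q ⟨hQ, hdQ⟩ ↦
      ⟨hQ, hle.trans (by simpa [Ideal.span_le])⟩)
  have hMprime := IsTIdeal.isPrime_of_maximal htop hmul hM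
  obtain ⟨P, hMP, hP⟩ := hM.1.1.exists_le_isMaximalTIdeal hMprime.ne_top
  have hPprime := hP.isPrime
  obtain ⟨V, hV⟩ := hD.exists_isLocalizationAt hP
  -- Rank one leaves no nonzero prime strictly below `P`, so `M = P`.
  have hPM := hV.le_of_ringKrullDim_eq_one ((hpot P hP).ringKrullDim_eq_one hcic hP hV)
    hM.1.1.1 hMP
  obtain ⟨J, -, hJfg, hJP, hJ⟩ := hpot P hP
  exact hM.1.2 J ⟨hJfg, (Set.finite_singleton P).subset fun Q ⟨hQ, hle⟩ ↦ hJ Q hQ hle⟩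
    (hJP.trans hPM)

theorem IsPVMD.isGeneralizedKrull (hD : IsPVMD D K) (hcic : IsCompletelyIntegrallyClosed D K)
    (hpot : ∀ P : Ideal D, IsMaximalTIdeal K P → IsPotent K P) : IsGeneralizedKrull D K := by
  refine ⟨{V | ∃ P : Ideal D, IsMaximalTIdeal K P ∧ IsLocalizationAt V P}, ?_, fun x ↦ ⟨?_, ?_⟩,
    fun d hd ↦ ?_⟩
  · rintro V ⟨P, hP, hV⟩
    exact ⟨isEssential_iff.mpr ⟨P, hP.isPrime, hV⟩, (hpot P hP).ringKrullDim_eq_one hcic hP hV⟩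
  · rintro ⟨d, rfl⟩ V ⟨P, hP, hV⟩
    have := hP.isPrime
    exact hV.algebraMap_mem d
  · intro h
    refine mem_range_of_forall_isMaximalTIdeal fun P hP ↦ ?_
    obtain ⟨V, hV⟩ := hD.exists_isLocalizationAt hP
    exact (hV x).mp (h V ⟨P, hP, hV⟩)
  · refine ((hD.finite_isMaximalTIdeal hcic hpot hd).biUnion
      (t := fun P ↦ {V | IsLocalizationAt V P}) fun P _ ↦ Set.Subsingleton.finite ?_).subset ?_
    · exact fun V hV W hW ↦ ValuationSubring.ext V W fun x ↦ (hV x).trans (hW x).symm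
    · rintro V ⟨⟨P, hP, hV⟩, hdV⟩
      have := hP.isPrime
      exact Set.mem_biUnion (x := P) ⟨hP, hV.algebraMap_mem_nonunits.mp hdV⟩ hV

end GeneralizedKrull

end TOperation

theorem theorem3p3 (D K : Type*) [CommRing D] [IsDomain D] [Field K] [Algebra D K]
    [IsFractionRing D K] (hD : TOperation.IsPVMD D K) :
    TOperation.IsGeneralizedKrull D K ↔
      TOperation.IsCompletelyIntegrallyClosed D K ∧
        ∀ P : Ideal D, TOperation.IsMaximalTIdeal K P → TOperation.IsPotent K P :=
  ⟨fun h ↦ ⟨h.isCompletelyIntegrallyClosed, fun _ hP ↦ h.isPotent hP⟩,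
    fun ⟨hcic, hpot⟩ ↦ hD.isGeneralizedKrull hcic hpot⟩
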